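/- For $w\in\mathbb C$ let $\sqrt w$ denote the square root $\sqrt{r e^{i\theta}}=\sqrt r\,e^{i\theta/2}$, $\theta\in[0,2\pi)$, i.e. the square root with nonnegative imaginary part whenever $w\notin[0,\infty)$; thus $\sqrt{i}=\frac{1+i}{\sqrt2}$ and $\sqrt{-i}=\frac{-1+i}{\sqrt2}$. On $L^2(0,\infty)$ consider the differential expression $K_1=-\frac{d^2}{dx^2}$ with maximal and minimal domains $$\operatorname{dom}K_{1,\max}=\{f\in L^2(0,\infty): f,f'\in AC_{\rm loc}(0,\infty),\ -f''\in L^2(0,\infty)\},$$ $$\operatorname{dom}K_{1,\min}=\{f\in\operatorname{dom}K_{1,\max}:\ \lim_{x\to0^+}f(x)=\lim_{x\to0^+}f'(x)=0\},$$ and, for $f\in\operatorname{dom}K_{1,\max}$, put $f(0)=\lim_{x\to0^+}f(x)$ and $f'(0)=\lim_{x\to0^+}f'(x)$. Let $\phi^+(x)=\sqrt[4]{2}\,e^{\sqrt{-i}\,x}$ and $\phi^-(x)=\sqrt[4]{2}\,e^{-\sqrt{i}\,x}$ be the normalized defect vectors. For $\alpha\in\mathbb C$ with $|\alpha|=1$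 let $$\operatorname{dom}K_{1,\alpha}=\operatorname{dom}K_{1,\min}+\operatorname{span}\{\alpha\phi^--\phi^+\},$$ and for $b,c\in\mathbb C$ with $|b|=|c|=1$ and $b\overline c\in\mathbb R$ let $$\operatorname{dom}K_1(b,c)=\{f\in\operatorname{dom}K_{1,\max}:\ b f(0)+c f'(0)=0\}.$$ Then $b-c\sqrt i\ne0$, the number $\frac{b+c\sqrt{-i}}{b-c\sqrt i}$ has modulus $1$, and $$\operatorname{dom}K_{1,\alpha}=\operatorname{dom}K_1(b,c)\quad\Longleftrightarrow\quad \alpha=\frac{b+c\sqrt{-i}}{b-c\sqrt{i}}.$$ -/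

import Mathlib

open MeasureTheory Filter Topology
open scoped Pointwise

noncomputable section

namespace HalfLine

/-- The Hilbert space `L²(0, ∞)` of complex-valued functions. -/
abbrev L2 : Type := Lp ℂ 2 (volume.restrict (Set.Ioi (0 : ℝ)))

/-- The square root with values in the closed upper half-plane, i.e.
`√(r e^{iθ}) = √r e^{iθ/2}` for `r ≥ 0` and `θ ∈ [0, 2π)`. -/
def usqrt (w : ℂ) : ℂ :=
  if 0 ≤ (w ^ (1 / 2 : ℂ)).im then w ^ (1 / 2 : ℂ) else -w ^ (1 / 2 : ℂ)

theorem usqrt_sq (w : ℂ) : usqrt w ^ 2 = w := by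
  have h : (w ^ (1 / 2 : ℂ)) ^ 2 = w := by
    simp
  unfold usqrt
  split_ifs
  · exact h
  · rw [neg_sq, h]

theorem usqrt_im_nonneg (w : ℂ) : 0 ≤ (usqrt w).im := by
  unfold usqrt
  split_ifs with h
  · exact h
  · simp only [Complex.neg_im]
    linarith [not_le.mp h]

theorem usqrt_I : usqrt Complex.I = ((1 / √2 : ℝ) : ℂ) * (1 + Complex.I) := by
  have h1 := usqrt_sq Complex.I
  have h2 := usqrt_im_nonneg Complex.I
  set z := usqrt Complex.I
  have hs : (√2 : ℝ) ^ 2 = 2 := Real.sq_sqrt (by norm_num)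
  have hre : z.re * z.re - z.im * z.im = 0 := by
    have := congrArg Complex.re h1; simpa [pow_two] using this
  have him : z.re * z.im + z.im * z.re = 1 := by
    have := congrArg Complex.im h1; simpa [pow_two] using this
  have hpos : 0 < √2 := by positivity
  have e : z.re = z.im := by
    rcases mul_eq_zero.mp (show (z.re - z.im) * (z.re + z.im) = 0 by linarith) with h | h
    · linarith
    · nlinarith
  have k : z.im = 1 / √2 := by
    rw [e] at him
    rw [eq_div_iff hpos.ne']
    have : (z.im * √2) ^ 2 = 1 := by rw [mul_pow, hs]; linarith
    nlinarith [mul_nonneg h2 hpos.le]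
  apply Complex.ext <;> simp [e, k] <;> field_simp <;> simp [hs]

theorem usqrt_neg_I : usqrt (-Complex.I) = ((1 / √2 : ℝ) : ℂ) * (-1 + Complex.I) := by
  have h1 := usqrt_sq (-Complex.I)
  have h2 := usqrt_im_nonneg (-Complex.I)
  set z := usqrt (-Complex.I)
  have hs : (√2 : ℝ) ^ 2 = 2 := Real.sq_sqrt (by norm_num)
  have hre : z.re * z.re - z.im * z.im = 0 := by
    have := congrArg Complex.re h1; simpa [pow_two] using this
  have him : z.re * z.im + z.im * z.re = -1 := by
    have := congrArg Complex.im h1; simpa [pow_two] using this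
  have hpos : 0 < √2 := by positivity
  have e : z.re = -z.im := by
    rcases mul_eq_zero.mp (show (z.re - z.im) * (z.re + z.im) = 0 by linarith) with h | h
    · nlinarith
    · linarith
  have k : z.im = 1 / √2 := by
    rw [e] at him
    rw [eq_div_iff hpos.ne']
    have : (z.im * √2) ^ 2 = 1 := by rw [mul_pow, hs]; linarith
    nlinarith [mul_nonneg h2 hpos.le]
  apply Complex.ext <;> simp [e, k] <;> field_simp <;> simp [hs]

/-- `f ∈ AC_loc(0, ∞)`: absolute continuity on every compact subinterval of `(0, ∞)`. -/
def LocAC (f : ℝ → ℂ) : Prop :=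
  ∀ x y : ℝ, 0 < x → x ≤ y → AbsolutelyContinuousOnInterval f x y

/-- `g` is a representative of the class `f ∈ L²(0, ∞)` with `g, g' ∈ AC_loc(0, ∞)` and
`-g'' ∈ L²(0, ∞)`. On `(0, ∞)` such a representative is unique. -/
structure IsMaxRep (f : L2) (g : ℝ → ℂ) : Prop where
  ae_eq : f =ᵐ[volume.restrict (Set.Ioi (0 : ℝ))] g
  locAC : LocAC g
  locAC_deriv : LocAC (deriv g)
  memLp : MemLp (fun x => -deriv (deriv g) x) 2 (volume.restrict (Set.Ioi (0 : ℝ)))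

/-- The domain of the maximal operator of `-d²/dx²` on `(0, ∞)`. -/
def domKmax : Set L2 := {f | ∃ g : ℝ → ℂ, IsMaxRep f g}

/-- The domain of the minimal operator of `-d²/dx²` on `(0, ∞)`. -/
def domKmin : Set L2 :=
  {f | ∃ g : ℝ → ℂ, IsMaxRep f g ∧
    Tendsto g (𝓝[>] 0) (𝓝 0) ∧ Tendsto (deriv g) (𝓝[>] 0) (𝓝 0)}

/-- The continuous representative, with continuous derivative on `(0, ∞)`, of an element of the
maximal domain (and `0` for other classes). -/
def rep (f : L2) : ℝ → ℂ :=
  open Classical in if h : ∃ g : ℝ → ℂ, IsMaxRep f g then h.choose else 0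

/-- `f(0) := lim_{x → 0+} f(x)`. -/
def value0 (f : L2) : ℂ := limUnder (𝓝[>] (0 : ℝ)) (rep f)

/-- `f'(0) := lim_{x → 0+} f'(x)`. -/
def deriv0 (f : L2) : ℂ := limUnder (𝓝[>] (0 : ℝ)) (deriv (rep f))

theorem memLp_exp {z : ℂ} (hz : z.re < 0) (k : ℂ) :
    MemLp (fun x : ℝ => k * Complex.exp (z * x)) 2 (volume.restrict (Set.Ioi (0 : ℝ))) := by
  apply MemLp.const_mul
  rw [memLp_two_iff_integrable_sq_norm (by fun_prop)]
  have h := integrableOn_exp_mul_Ioi (a := 2 * z.re) (by linarith) 0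
  refine h.congr (Eventually.of_forall fun x => ?_)
  simp only [Complex.norm_exp, ← Real.exp_nat_mul]
  congr 1
  simp
  ring

theorem usqrt_neg_I_re : (usqrt (-Complex.I)).re < 0 := by
  rw [usqrt_neg_I]; simp

theorem neg_usqrt_I_re : (-usqrt Complex.I).re < 0 := by
  rw [usqrt_I]; simp

/-- The defect vector `φ⁺(x) = 2^{1/4} e^{√(-i) x}`. -/
def phiPlus : L2 :=
  (memLp_exp usqrt_neg_I_re (((2 : ℝ) ^ (1 / 4 : ℝ) : ℝ) : ℂ)).toLp _

/-- The defect vector `φ⁻(x) = 2^{1/4} e^{-√i x}`. -/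
def phiMinus : L2 :=
  (memLp_exp neg_usqrt_I_re (((2 : ℝ) ^ (1 / 4 : ℝ) : ℝ) : ℂ)).toLp _

/-- `dom K_{1,α} = dom K_{1,min} + span {α φ⁻ - φ⁺}`. -/
def domKalpha (α : ℂ) : Set L2 :=
  domKmin + (Submodule.span ℂ {α • phiMinus - phiPlus} : Set L2)

/-- `dom K₁(b, c) = {f ∈ dom K_{1,max} : b f(0) + c f'(0) = 0}`. -/
def domKbc (b c : ℂ) : Set L2 :=
  {f | f ∈ domKmax ∧ b * value0 f + c * deriv0 f = 0}

end HalfLine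

end

/-!
The boundary trace `f ↦ (f(0), f'(0))` is a linear map from the maximal domain to `ℂ²` whose
kernel is the minimal domain. The domain `K_{1,α}` is therefore the kernel of the trace enlarged
by one vector, while `K₁(b, c)` is the kernel of the trace followed by the nonzero functional
`(v, w) ↦ b v + c w`. As `ℂ²` is two-dimensional, the two agree exactly when this functional
vanishes on the trace `⁴√2 (α - 1, -(α √i + √(-i)))` of `α φ⁻ - φ⁺`, a linear equation in `α`
whose solution has modulus one because `√(-i) = -conj √i` and `b conj c` is real.

The trace exists because `g'' ∈ L²` is integrable near `0`, so that `g'`, and then `g`, extend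
continuously to `0` by the fundamental theorem of calculus for absolutely continuous functions.
-/

namespace HalfLine

section AbsolutelyContinuous

variable {F : Type*} [NormedAddCommGroup F] [NormedSpace ℝ F]

theorem absolutelyContinuousOnInterval_of_dist_le_mul {X Y : Type*} [PseudoMetricSpace X]
    [PseudoMetricSpace Y] {f : ℝ → X} {g : ℝ → Y} {a b : ℝ} (K : ℝ)
    (hf : AbsolutelyContinuousOnInterval f a b)
    (hfg : ∀ x ∈ Set.uIcc a b, ∀ y ∈ Set.uIcc a b, dist (g x) (g y) ≤ K * dist (f x) (f y)) :
    AbsolutelyContinuousOnInterval g a b := by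
  refine squeeze_zero' (Eventually.of_forall fun E => Finset.sum_nonneg fun i _ => dist_nonneg)
    ?_ (by simpa only [mul_zero] using Tendsto.const_mul K hf)
  filter_upwards [mem_inf_of_right (mem_principal_self _)] with E hE
  rw [Finset.mul_sum]
  exact Finset.sum_le_sum fun i hi => hfg _ (hE.1 i hi).1 _ (hE.1 i hi).2

theorem absolutelyContinuousOnInterval_clm_comp {G : Type*} [NormedAddCommGroup G]
    [NormedSpace ℝ G] {f : ℝ → F} {a b : ℝ} (L : F →L[ℝ] G)
    (hf : AbsolutelyContinuousOnInterval f a b) :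
    AbsolutelyContinuousOnInterval (fun x => L (f x)) a b :=
  absolutelyContinuousOnInterval_of_dist_le_mul ‖L‖ hf fun x _ y _ => by
    simpa only [dist_eq_norm, map_sub] using L.le_opNorm (f x - f y)

variable [FiniteDimensional ℝ F] {f : ℝ → F} {a b : ℝ}

theorem ae_deriv_clm_comp_of_absolutelyContinuousOnInterval {G : Type*} [NormedAddCommGroup G]
    [NormedSpace ℝ G] (L : F →L[ℝ] G) (hf : AbsolutelyContinuousOnInterval f a b) :
    (deriv fun x => L (f x)) =ᵐ[volume.restrict (Set.uIoc a b)] fun x => L (deriv f x) := by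
  filter_upwards [ae_restrict_of_ae hf.boundedVariationOn.ae_differentiableAt_of_mem_uIcc,
    ae_restrict_mem measurableSet_uIoc] with x hfx hx
  exact (L.hasFDerivAt.comp_hasDerivAt x (hfx (Set.uIoc_subset_uIcc hx)).hasDerivAt).deriv

theorem intervalIntegrable_deriv_of_absolutelyContinuousOnInterval
    (hf : AbsolutelyContinuousOnInterval f a b) : IntervalIntegrable (deriv f) volume a b := by
  let e := Module.finBasis ℝ F
  have hcoord (i) : IntervalIntegrable (fun x => e.coord i (deriv f x)) volume a b :=
    let L := (e.coord i).toContinuousLinearMap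
    (absolutelyContinuousOnInterval_clm_comp L hf).intervalIntegrable_deriv.congr_ae
      (ae_deriv_clm_comp_of_absolutelyContinuousOnInterval L hf)
  have hsum : IntervalIntegrable (∑ i, fun x => e.coord i (deriv f x) • e i) volume a b :=
    IntervalIntegrable.sum Finset.univ fun i _ =>
      ⟨(hcoord i).1.smul_const (e i), (hcoord i).2.smul_const (e i)⟩
  refine hsum.congr fun x _ => ?_
  rw [Finset.sum_apply]
  exact e.sum_repr (deriv f x)

theorem integral_deriv_eq_sub_of_absolutelyContinuousOnInterval
    (hf : AbsolutelyContinuousOnInterval f a b) : ∫ x in a..b, deriv f x = f b - f a := by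
  have : CompleteSpace F := FiniteDimensional.complete ℝ F
  refine (Module.finBasis ℝ F).ext_elem fun i => ?_
  let L := ((Module.finBasis ℝ F).coord i).toContinuousLinearMap
  calc L (∫ x in a..b, deriv f x)
      = ∫ x in a..b, L (deriv f x) := (L.intervalIntegral_comp_comm
        (intervalIntegrable_deriv_of_absolutelyContinuousOnInterval hf)).symm
    _ = ∫ x in a..b, deriv (fun x => L (f x)) x :=
        intervalIntegral.integral_congr_ae_restrict
          (ae_deriv_clm_comp_of_absolutelyContinuousOnInterval L hf).symm
    _ = L (f b) - L (f a) :=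
        (absolutelyContinuousOnInterval_clm_comp L hf).integral_deriv_eq_sub
    _ = L (f b - f a) := (map_sub L _ _).symm

theorem exists_tendsto_nhdsGT_of_integrableOn_deriv (hab : a < b)
    (hf : ∀ x ∈ Set.Ioc a b, AbsolutelyContinuousOnInterval f x b)
    (hf' : IntegrableOn (deriv f) (Set.Ioc a b)) : ∃ v, Tendsto f (𝓝[>] a) (𝓝 v) := by
  have hprim : ContinuousOn (fun x => ∫ t in x..b, deriv f t) (Set.Icc a b) := by
    rw [← Set.uIcc_of_le hab.le]
    apply intervalIntegral.continuousOn_primitive_interval_left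
    rwa [Set.uIcc_of_le hab.le, integrableOn_Icc_iff_integrableOn_Ioc]
  have hlim : Tendsto (fun x => f b - ∫ t in x..b, deriv f t) (𝓝[>] a)
      (𝓝 (f b - ∫ t in a..b, deriv f t)) :=
    ((hprim a (Set.left_mem_Icc.2 hab.le)).mono_left
      (nhdsWithin_le_of_mem (Icc_mem_nhdsGT hab))).const_sub (f b)
  refine ⟨_, hlim.congr' ?_⟩
  filter_upwards [Ioc_mem_nhdsGT hab] with x hx
  rw [integral_deriv_eq_sub_of_absolutelyContinuousOnInterval (hf x hx), sub_sub_cancel]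

end AbsolutelyContinuous

theorem integrableOn_Ioc_of_tendsto {E : Type*} [NormedAddCommGroup E] {f : ℝ → E} {a b : ℝ}
    {v : E} (hf : ContinuousOn f (Set.Ioc a b)) (hv : Tendsto f (𝓝[>] a) (𝓝 v)) :
    IntegrableOn f (Set.Ioc a b) := by
  have hcont : ContinuousOn (Function.update f a v) (Set.Icc a b) := by
    rw [continuousOn_update_iff, Set.Icc_sdiff_left]
    exact ⟨hf, fun _ => hv.mono_left (nhdsWithin_mono a Set.Ioc_subset_Ioi_self)⟩
  refine (hcont.integrableOn_Icc.mono_set Set.Ioc_subset_Icc_self).congr_fun (fun x hx => ?_)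
    measurableSet_Ioc
  exact Function.update_of_ne hx.1.ne' _ _

namespace LocAC

variable {f g : ℝ → ℂ}

theorem congr (hf : LocAC f) (hfg : Set.EqOn f g (Set.Ioi 0)) : LocAC g := by
  intro x y hx hxy
  refine absolutelyContinuousOnInterval_of_dist_le_mul 1 (hf x y hx hxy) fun s hs t ht => ?_
  rw [Set.uIcc_of_le hxy] at hs ht
  rw [hfg (hx.trans_le hs.1), hfg (hx.trans_le ht.1), one_mul]

theorem absolutelyContinuousOnInterval (hf : LocAC f) {x y : ℝ} (hx : 0 < x) (hy : 0 < y) :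
    AbsolutelyContinuousOnInterval f x y :=
  (le_total x y).elim (hf x y hx) fun hyx => (hf y x hy hyx).symm

theorem add (hf : LocAC f) (hg : LocAC g) : LocAC (fun x => f x + g x) :=
  fun x y hx hxy => (hf x y hx hxy).fun_add (hg x y hx hxy)

theorem const_mul (c : ℂ) (hf : LocAC f) : LocAC (fun x => c * f x) :=
  fun x y hx hxy => (hf x y hx hxy).const_smul c

theorem continuousOn (hf : LocAC f) : ContinuousOn f (Set.Ioi 0) := by
  intro x (hx : 0 < x)
  have hcont := (hf (x / 2) (x + 1) (half_pos hx) (by linarith)).continuousOn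
  rw [Set.uIcc_of_le (by linarith)] at hcont
  exact (hcont.continuousAt (Icc_mem_nhds (half_lt_self hx) (lt_add_one x))).continuousWithinAt

theorem ae_differentiableAt (hf : LocAC f) :
    ∀ᵐ x ∂volume.restrict (Set.Ioi (0 : ℝ)), DifferentiableAt ℝ f x := by
  have hbv : LocallyBoundedVariationOn f (Set.Ioi 0) := fun x y hx hy =>
    (hf.absolutelyContinuousOnInterval hx hy).boundedVariationOn.mono
      (Set.inter_subset_right.trans Set.Icc_subset_uIcc)
  filter_upwards [hbv.ae_differentiableWithinAt measurableSet_Ioi,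
    ae_restrict_mem measurableSet_Ioi] with x hfx hx
  exact hfx.differentiableAt (Ioi_mem_nhds hx)

theorem hasDerivAt (hf : LocAC f) (hf' : ContinuousOn (deriv f) (Set.Ioi 0)) {x : ℝ}
    (hx : 0 < x) : HasDerivAt f (deriv f x) x := by
  have hprim : HasDerivAt (fun y => f x + ∫ t in x..y, deriv f t) (deriv f x) x :=
    (intervalIntegral.integral_hasDerivAt_right IntervalIntegrable.refl
      (hf'.stronglyMeasurableAtFilter isOpen_Ioi x hx)
      (hf'.continuousAt (Ioi_mem_nhds hx))).const_add _
  refine hprim.congr_of_eventuallyEq ?_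
  filter_upwards [Ioi_mem_nhds hx] with y hy
  rw [integral_deriv_eq_sub_of_absolutelyContinuousOnInterval
    (hf.absolutelyContinuousOnInterval hx hy), add_sub_cancel]

theorem exists_tendsto (hf : LocAC f) (hf' : IntegrableOn (deriv f) (Set.Ioc 0 1)) :
    ∃ v, Tendsto f (𝓝[>] 0) (𝓝 v) :=
  exists_tendsto_nhdsGT_of_integrableOn_deriv zero_lt_one (fun x hx => hf x 1 hx.1 hx.2) hf'

end LocAC

namespace IsMaxRep

variable {f₁ f₂ f : L2} {g₁ g₂ g : ℝ → ℂ}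

theorem hasDerivAt (hg : IsMaxRep f g) {x : ℝ} (hx : 0 < x) : HasDerivAt g (deriv g x) x :=
  hg.locAC.hasDerivAt hg.locAC_deriv.continuousOn hx

theorem eqOn (hg₁ : IsMaxRep f g₁) (hg₂ : IsMaxRep f g₂) : Set.EqOn g₁ g₂ (Set.Ioi 0) :=
  Measure.eqOn_open_of_ae_eq (hg₁.ae_eq.symm.trans hg₂.ae_eq) isOpen_Ioi
    hg₁.locAC.continuousOn hg₂.locAC.continuousOn

theorem deriv_eqOn (hg₁ : IsMaxRep f g₁) (hg₂ : IsMaxRep f g₂) :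
    Set.EqOn (deriv g₁) (deriv g₂) (Set.Ioi 0) :=
  (hg₁.eqOn hg₂).deriv isOpen_Ioi

theorem deriv_add_eqOn (hg₁ : IsMaxRep f₁ g₁) (hg₂ : IsMaxRep f₂ g₂) :
    Set.EqOn (fun x => deriv g₁ x + deriv g₂ x) (deriv fun x => g₁ x + g₂ x) (Set.Ioi 0) :=
  fun _ hx => ((hg₁.hasDerivAt hx).fun_add (hg₂.hasDerivAt hx)).deriv.symm

theorem add (hg₁ : IsMaxRep f₁ g₁) (hg₂ : IsMaxRep f₂ g₂) :
    IsMaxRep (f₁ + f₂) (fun x => g₁ x + g₂ x) where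
  ae_eq := (Lp.coeFn_add f₁ f₂).trans (hg₁.ae_eq.add hg₂.ae_eq)
  locAC := hg₁.locAC.add hg₂.locAC
  locAC_deriv := (hg₁.locAC_deriv.add hg₂.locAC_deriv).congr (hg₁.deriv_add_eqOn hg₂)
  memLp := by
    refine (hg₁.memLp.add hg₂.memLp).ae_eq ?_
    filter_upwards [hg₁.locAC_deriv.ae_differentiableAt, hg₂.locAC_deriv.ae_differentiableAt,
      ae_restrict_mem measurableSet_Ioi] with x hx₁ hx₂ hx
    rw [Pi.add_apply, ← (hg₁.deriv_add_eqOn hg₂).deriv isOpen_Ioi hx, deriv_fun_add hx₁ hx₂,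
      neg_add]

theorem const_smul (c : ℂ) (hg : IsMaxRep f g) : IsMaxRep (c • f) (fun x => c * g x) where
  ae_eq := (Lp.coeFn_smul c f).trans (hg.ae_eq.const_smul c)
  locAC := hg.locAC.const_mul c
  locAC_deriv := by
    rw [deriv_const_mul_field']
    exact hg.locAC_deriv.const_mul c
  memLp := by
    simpa only [deriv_const_mul_field', mul_neg] using hg.memLp.const_mul c

theorem integrableOn_deriv_deriv (hg : IsMaxRep f g) :
    IntegrableOn (deriv (deriv g)) (Set.Ioc 0 1) := by
  have hL2 : MemLp (fun x => -deriv (deriv g) x) 2 (volume.restrict (Set.Ioc (0 : ℝ) 1)) :=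
    hg.memLp.mono_measure (Measure.restrict_mono Set.Ioc_subset_Ioi_self le_rfl)
  simpa only [IntegrableOn, Pi.neg_def, neg_neg] using (hL2.integrable one_le_two).neg

theorem exists_tendsto_deriv (hg : IsMaxRep f g) : ∃ w, Tendsto (deriv g) (𝓝[>] 0) (𝓝 w) :=
  hg.locAC_deriv.exists_tendsto hg.integrableOn_deriv_deriv

theorem exists_tendsto (hg : IsMaxRep f g) : ∃ v, Tendsto g (𝓝[>] 0) (𝓝 v) :=
  have ⟨_, hw⟩ := hg.exists_tendsto_deriv
  hg.locAC.exists_tendsto <| integrableOn_Ioc_of_tendsto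
    (hg.locAC_deriv.continuousOn.mono Set.Ioc_subset_Ioi_self) hw

theorem isMaxRep_rep (hg : IsMaxRep f g) : IsMaxRep f (rep f) := by
  have hf : ∃ g : ℝ → ℂ, IsMaxRep f g := ⟨g, hg⟩
  rw [rep, dif_pos hf]
  exact hf.choose_spec

theorem tendsto_value0 (hg : IsMaxRep f g) : Tendsto g (𝓝[>] 0) (𝓝 (value0 f)) :=
  (tendsto_nhds_limUnder hg.isMaxRep_rep.exists_tendsto).congr'
    (eventually_mem_nhdsWithin.mono (hg.isMaxRep_rep.eqOn hg))

theorem tendsto_deriv0 (hg : IsMaxRep f g) : Tendsto (deriv g) (𝓝[>] 0) (𝓝 (deriv0 f)) :=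
  (tendsto_nhds_limUnder hg.isMaxRep_rep.exists_tendsto_deriv).congr'
    (eventually_mem_nhdsWithin.mono (hg.isMaxRep_rep.deriv_eqOn hg))

theorem value0_eq (hg : IsMaxRep f g) {v : ℂ} (hv : Tendsto g (𝓝[>] 0) (𝓝 v)) :
    value0 f = v :=
  tendsto_nhds_unique hg.tendsto_value0 hv

theorem deriv0_eq (hg : IsMaxRep f g) {w : ℂ} (hw : Tendsto (deriv g) (𝓝[>] 0) (𝓝 w)) :
    deriv0 f = w :=
  tendsto_nhds_unique hg.tendsto_deriv0 hw

end IsMaxRep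

section Exponential

theorem deriv_const_mul_exp (k z : ℂ) :
    (deriv fun x : ℝ => k * Complex.exp (z * x)) = fun x : ℝ => k * z * Complex.exp (z * x) := by
  ext x
  have hexp : HasDerivAt (fun x : ℝ => Complex.exp (z * x)) (Complex.exp (z * x) * (z * 1)) x :=
    ((hasDerivAt_id x).ofReal_comp.const_mul z).cexp
  rw [(hexp.const_mul k).deriv]
  ring

theorem locAC_const_mul_exp (k z : ℂ) : LocAC (fun x : ℝ => k * Complex.exp (z * x)) :=
  fun _ _ _ _ => ContDiffOn.absolutelyContinuousOnInterval
    (contDiff_const.mul (contDiff_const.mul Complex.ofRealCLM.contDiff).cexp).contDiffOn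

theorem tendsto_const_mul_exp (k z : ℂ) :
    Tendsto (fun x : ℝ => k * Complex.exp (z * x)) (𝓝[>] 0) (𝓝 k) := by
  have hcont : Continuous (fun x : ℝ => k * Complex.exp (z * x)) := by fun_prop
  simpa using (hcont.tendsto 0).mono_left nhdsWithin_le_nhds

variable {z : ℂ} (hz : z.re < 0) (k : ℂ)
include hz

theorem isMaxRep_const_mul_exp :
    IsMaxRep ((memLp_exp hz k).toLp _) (fun x : ℝ => k * Complex.exp (z * x)) where
  ae_eq := (memLp_exp hz k).coeFn_toLp
  locAC := locAC_const_mul_exp k z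
  locAC_deriv := by
    rw [deriv_const_mul_exp]
    exact locAC_const_mul_exp _ z
  memLp := by
    simp only [deriv_const_mul_exp]
    exact (memLp_exp hz _).neg

theorem value0_const_mul_exp : value0 ((memLp_exp hz k).toLp _) = k :=
  (isMaxRep_const_mul_exp hz k).value0_eq (tendsto_const_mul_exp k z)

theorem deriv0_const_mul_exp : deriv0 ((memLp_exp hz k).toLp _) = k * z :=
  (isMaxRep_const_mul_exp hz k).deriv0_eq <| by
    rw [deriv_const_mul_exp]
    exact tendsto_const_mul_exp _ z

end Exponential

section Trace

variable {f₁ f₂ f : L2}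

theorem value0_add (hf₁ : f₁ ∈ domKmax) (hf₂ : f₂ ∈ domKmax) :
    value0 (f₁ + f₂) = value0 f₁ + value0 f₂ :=
  have ⟨_, hg₁⟩ := hf₁
  have ⟨_, hg₂⟩ := hf₂
  (hg₁.add hg₂).value0_eq (hg₁.tendsto_value0.add hg₂.tendsto_value0)

theorem deriv0_add (hf₁ : f₁ ∈ domKmax) (hf₂ : f₂ ∈ domKmax) :
    deriv0 (f₁ + f₂) = deriv0 f₁ + deriv0 f₂ :=
  have ⟨_, hg₁⟩ := hf₁
  have ⟨_, hg₂⟩ := hf₂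
  (hg₁.add hg₂).deriv0_eq <| (hg₁.tendsto_deriv0.add hg₂.tendsto_deriv0).congr'
    (eventually_mem_nhdsWithin.mono (hg₁.deriv_add_eqOn hg₂))

theorem value0_smul (c : ℂ) (hf : f ∈ domKmax) : value0 (c • f) = c * value0 f :=
  have ⟨_, hg⟩ := hf
  (hg.const_smul c).value0_eq (hg.tendsto_value0.const_mul c)

theorem deriv0_smul (c : ℂ) (hf : f ∈ domKmax) : deriv0 (c • f) = c * deriv0 f :=
  have ⟨_, hg⟩ := hf
  (hg.const_smul c).deriv0_eq <| by
    rw [deriv_const_mul_field']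
    exact hg.tendsto_deriv0.const_mul c

theorem phiPlus_mem_domKmax : phiPlus ∈ domKmax := ⟨_, isMaxRep_const_mul_exp usqrt_neg_I_re _⟩

theorem phiMinus_mem_domKmax : phiMinus ∈ domKmax := ⟨_, isMaxRep_const_mul_exp neg_usqrt_I_re _⟩

/-- The maximal domain `dom K_{1,max}` as a subspace of `L²(0, ∞)`. -/
def maxDomain : Submodule ℂ L2 where
  carrier := domKmax
  zero_mem' := by
    obtain ⟨_, hg⟩ := phiPlus_mem_domKmax
    exact zero_smul ℂ phiPlus ▸ ⟨_, hg.const_smul 0⟩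
  add_mem' := fun ⟨_, hg₁⟩ ⟨_, hg₂⟩ => ⟨_, hg₁.add hg₂⟩
  smul_mem' := fun c _ ⟨_, hg⟩ => ⟨_, hg.const_smul c⟩

/-- The boundary trace `f ↦ (f(0), f'(0))` on the maximal domain. -/
noncomputable def trace : maxDomain →ₗ[ℂ] ℂ × ℂ where
  toFun f := (value0 f, deriv0 f)
  map_add' f₁ f₂ := Prod.ext (value0_add f₁.2 f₂.2) (deriv0_add f₁.2 f₂.2)
  map_smul' c f := Prod.ext (value0_smul c f.2) (deriv0_smul c f.2)

/-- The functional `(v, w) ↦ b v + c w` on boundary values, which cuts out `dom K₁(b, c)`. -/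
noncomputable def boundaryForm (b c : ℂ) : Module.Dual ℂ (ℂ × ℂ) :=
  b • LinearMap.fst ℂ ℂ ℂ + c • LinearMap.snd ℂ ℂ ℂ

/-- The vector `α φ⁻ - φ⁺`, which spans `dom K_{1,α}` over the minimal domain. -/
noncomputable def defectVector (α : ℂ) : maxDomain :=
  α • ⟨phiMinus, phiMinus_mem_domKmax⟩ - ⟨phiPlus, phiPlus_mem_domKmax⟩

theorem domKmin_eq_map_ker_trace :
    domKmin = (LinearMap.ker trace).map maxDomain.subtype := by
  ext f
  constructor
  · rintro ⟨g, hg, hv, hw⟩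
    exact ⟨⟨f, g, hg⟩, Prod.ext (hg.value0_eq hv) (hg.deriv0_eq hw), rfl⟩
  · rintro ⟨⟨f, g, hg⟩, hf, rfl⟩
    have hv : value0 f = 0 := congrArg Prod.fst hf
    have hw : deriv0 f = 0 := congrArg Prod.snd hf
    exact ⟨g, hg, hv ▸ hg.tendsto_value0, hw ▸ hg.tendsto_deriv0⟩

theorem domKalpha_eq_map (α : ℂ) :
    domKalpha α = (LinearMap.ker trace ⊔ ℂ ∙ defectVector α).map maxDomain.subtype := by
  rw [Submodule.map_sup, Submodule.coe_sup, Submodule.map_span, Set.image_singleton,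
    ← domKmin_eq_map_ker_trace]
  rfl

theorem domKbc_eq_map (b c : ℂ) :
    domKbc b c = (LinearMap.ker (boundaryForm b c ∘ₗ trace)).map maxDomain.subtype := by
  ext f
  constructor
  · rintro ⟨hf, hbc⟩
    exact ⟨⟨f, hf⟩, hbc, rfl⟩
  · rintro ⟨⟨f, hf⟩, hbc, rfl⟩
    exact ⟨hf, hbc⟩

end Trace

section Extension

theorem ker_sup_span_singleton_eq_ker_comp_iff {K V W : Type*} [Field K] [AddCommGroup V]
    [Module K V] [AddCommGroup W] [Module K W] (hW : Module.finrank K W = 2) (T : V →ₗ[K] W)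
    {φ : Module.Dual K W} (hφ : φ ≠ 0) {d : V} (hd : T d ≠ 0) :
    LinearMap.ker T ⊔ K ∙ d = LinearMap.ker (φ ∘ₗ T) ↔ φ (T d) = 0 := by
  have : FiniteDimensional K W := Module.finite_of_finrank_eq_succ hW
  rw [sup_comm, ← Submodule.comap_map_eq, Submodule.map_span, Set.image_singleton,
    LinearMap.ker_comp]
  constructor
  · intro h
    exact h.le (Submodule.mem_span_singleton_self (T d))
  · intro h
    have hker := Module.Dual.finrank_ker_add_one_of_ne_zero hφ
    congr 1
    apply Submodule.eq_of_le_of_finrank_eq ((Submodule.span_singleton_le_iff_mem _ _).2 h)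
    rw [finrank_span_singleton hd]
    lia

theorem boundaryForm_ne_zero {b c : ℂ} (hbc : b ≠ 0 ∨ c ≠ 0) : boundaryForm b c ≠ 0 := by
  intro h
  have hb : b = 0 := by simpa [boundaryForm] using LinearMap.congr_fun h (1, 0)
  have hc : c = 0 := by simpa [boundaryForm] using LinearMap.congr_fun h (0, 1)
  tauto

theorem trace_defectVector (α : ℂ) :
    trace (defectVector α) =
      (((2 : ℝ) ^ (1 / 4 : ℝ) : ℝ) : ℂ) •
        (α - 1, -(α * usqrt Complex.I + usqrt (-Complex.I))) := by
  have hplus_value : value0 phiPlus = _ := value0_const_mul_exp usqrt_neg_I_re _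
  have hplus_deriv : deriv0 phiPlus = _ := deriv0_const_mul_exp usqrt_neg_I_re _
  have hminus_value : value0 phiMinus = _ := value0_const_mul_exp neg_usqrt_I_re _
  have hminus_deriv : deriv0 phiMinus = _ := deriv0_const_mul_exp neg_usqrt_I_re _
  rw [defectVector, map_sub, map_smul]
  apply Prod.ext
  · simp only [trace, LinearMap.coe_mk, AddHom.coe_mk, Prod.fst_sub, Prod.smul_fst, smul_eq_mul,
      hplus_value, hminus_value]
    ring
  · simp only [trace, LinearMap.coe_mk, AddHom.coe_mk, Prod.snd_sub, Prod.smul_snd, smul_eq_mul,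
      hplus_deriv, hminus_deriv]
    ring

theorem fourthRoot_two_ne_zero : (((2 : ℝ) ^ (1 / 4 : ℝ) : ℝ) : ℂ) ≠ 0 :=
  Complex.ofReal_ne_zero.2 (Real.rpow_pos_of_pos two_pos _).ne'

theorem usqrt_neg_I_eq_neg_conj : usqrt (-Complex.I) = -(starRingEnd ℂ) (usqrt Complex.I) := by
  rw [usqrt_I, usqrt_neg_I]
  apply Complex.ext <;> simp

theorem usqrt_I_im_ne_zero : (usqrt Complex.I).im ≠ 0 := by
  simp [usqrt_I]

theorem trace_defectVector_ne_zero (α : ℂ) : trace (defectVector α) ≠ 0 := by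
  rw [trace_defectVector]
  refine smul_ne_zero fourthRoot_two_ne_zero fun h => ?_
  obtain ⟨hα, hsum⟩ := Prod.mk_eq_zero.1 h
  rw [sub_eq_zero.1 hα, usqrt_neg_I_eq_neg_conj] at hsum
  have him := congrArg Complex.im hsum
  simp only [one_mul, Complex.neg_im, Complex.add_im, Complex.conj_im, Complex.zero_im] at him
  exact usqrt_I_im_ne_zero (by linarith)

theorem domKalpha_eq_domKbc_iff (α : ℂ) {b c : ℂ} (hbc : b ≠ 0 ∨ c ≠ 0) :
    domKalpha α = domKbc b c ↔
      b * (α - 1) = c * (α * usqrt Complex.I + usqrt (-Complex.I)) := by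
  rw [domKalpha_eq_map, domKbc_eq_map, SetLike.coe_set_eq,
    (Submodule.map_injective_of_injective maxDomain.injective_subtype).eq_iff,
    ker_sup_span_singleton_eq_ker_comp_iff (by simp) trace (boundaryForm_ne_zero hbc)
      (trace_defectVector_ne_zero α),
    trace_defectVector, map_smul, smul_eq_zero_iff_right fourthRoot_two_ne_zero]
  simp only [boundaryForm, LinearMap.add_apply, LinearMap.smul_apply, LinearMap.fst_apply,
    LinearMap.snd_apply, smul_eq_mul, mul_neg, add_neg_eq_zero]

end Extension

section Modulus

variable {b c : ℂ}

theorem sub_mul_ne_zero_of_im_mul_conj_eq_zero {z : ℂ} (hz : z.im ≠ 0) (hbc : b ≠ 0 ∨ c ≠ 0)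
    (hreal : (b * (starRingEnd ℂ) c).im = 0) : b - c * z ≠ 0 := by
  intro h
  obtain rfl : b = c * z := sub_eq_zero.1 h
  have hnormSq : Complex.normSq c * z.im = 0 := by
    rw [mul_right_comm, Complex.mul_conj, Complex.im_ofReal_mul] at hreal
    exact hreal
  have hc : c = 0 := by simpa [hz] using hnormSq
  simp [hc] at hbc

theorem norm_sub_mul_conj_of_im_mul_conj_eq_zero (z : ℂ)
    (hreal : (b * (starRingEnd ℂ) c).im = 0) : ‖b - c * (starRingEnd ℂ) z‖ = ‖b - c * z‖ := by
  have hcross (w : ℂ) : (b * (starRingEnd ℂ) (c * w)).re = (b * (starRingEnd ℂ) c).re * w.re := by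
    rw [map_mul, ← mul_assoc, Complex.mul_re, hreal, zero_mul, sub_zero, Complex.conj_re]
  rw [← sq_eq_sq₀ (norm_nonneg _) (norm_nonneg _), Complex.sq_norm, Complex.sq_norm,
    Complex.normSq_sub, Complex.normSq_sub, hcross, hcross, Complex.conj_re, Complex.normSq_mul,
    Complex.normSq_mul, Complex.normSq_conj]

end Modulus

end HalfLine

theorem mainTheorem11_general (α b c : ℂ) (hbc : b ≠ 0 ∨ c ≠ 0)
    (hreal : (b * (starRingEnd ℂ) c).im = 0) :
    b - c * HalfLine.usqrt Complex.I ≠ 0 ∧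
    ‖(b + c * HalfLine.usqrt (-Complex.I)) / (b - c * HalfLine.usqrt Complex.I)‖ = 1 ∧
    (HalfLine.domKalpha α = HalfLine.domKbc b c ↔
      α = (b + c * HalfLine.usqrt (-Complex.I)) / (b - c * HalfLine.usqrt Complex.I)) := by
  have hden := HalfLine.sub_mul_ne_zero_of_im_mul_conj_eq_zero HalfLine.usqrt_I_im_ne_zero hbc hreal
  refine ⟨hden, ?_, ?_⟩
  · rw [HalfLine.usqrt_neg_I_eq_neg_conj, mul_neg, ← sub_eq_add_neg, norm_div,
      HalfLine.norm_sub_mul_conj_of_im_mul_conj_eq_zero _ hreal, div_self (norm_ne_zero_iff.2 hden)]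
  · rw [HalfLine.domKalpha_eq_domKbc_iff α hbc, eq_div_iff hden]
    constructor <;> intro h <;> linear_combination h

theorem mainTheorem11 (α b c : ℂ) (hα : ‖α‖ = 1) (hb : ‖b‖ = 1) (hc : ‖c‖ = 1)
    (hbc : (b * (starRingEnd ℂ) c).im = 0) :
    b - c * HalfLine.usqrt Complex.I ≠ 0 ∧
    ‖(b + c * HalfLine.usqrt (-Complex.I)) / (b - c * HalfLine.usqrt Complex.I)‖ = 1 ∧
    (HalfLine.domKalpha α = HalfLine.domKbc b c ↔
      α = (b + c * HalfLine.usqrt (-Complex.I)) / (b - c * HalfLine.usqrt Complex.I)) :=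
  mainTheorem11_general α b c (Or.inl (norm_ne_zero_iff.1 (hb ▸ one_ne_zero))) hbc
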